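/- **Lemma (binary case).** Let $(h_i,y_i)_{i=1}^n$, $n\ge 1$, be training data with $h_i\in\mathbb R^d$ and labels $y_i\in\{1,2\}$; put $\upsilon_i=1$ if $y_i=1$ and $\upsilon_i=-1$ if $y_i=2$. Assume the data are linearly separable: there is $w\in\mathbb R^d$ with $\upsilon_i w^Th_i>0$ for all $i$. Let $\delta_1,\delta_2>0$, and let $\omega_1,\omega_2>0$, $\iota_1,\iota_2\in\mathbb R$. For $W=[w_1,w_2]\in\mathbb R^{d\times 2}$ and $w\in\mathbb R^d$ consider the unregularized losses $$L_{\mathrm{CDT}}(W)=\sum_i\log\Big(1+\sum_{c\ne y_i}e^{-(\delta_{y_i}w_{y_i}-\delta_cw_c)^Th_i}\Big),\qquad L_{\mathrm{LDT}}(W)=\sum_i\log\Big(1+\sum_{c\ne y_i}e^{-\delta_{y_i}(w_{y_i}-w_c)^Th_i}\Big),$$ $$L_{\mathrm{CE}}(w)=\sum_i\log\big(1+e^{-\upsilon_iw^Th_i}\big),\qquad L_{\mathrm{VS}}(w)=\sum_i\omega_{y_i}\log\big(1+e^{\iota_{y_i}}e^{-\upsilon_i\delta_{y_i}w^Th_i}\big)$$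 (so the binary VS loss has the same multiplicative parameters as LDT: $\delta_1$ for $\upsilon=1$ and $\delta_2$ for $\upsilon=-1$; the case $\omega\equiv1$, $\iota\equiv0$ is the purely multiplicative one). Parameter spaces carry the Euclidean (Frobenius) norm. Say that minimizing a loss $L$ *produces* the classifier $v$ if both of the following hold. - There are step sizes $\eta$ with $0<\eta<2/K$ for some Lipschitz constant $K$ of $\nabla L$, and for every such $\eta$ and every starting point the gradient descent iterates $w(t)$ satisfy $L(w(t))\to\inf L$, $\|w(t)\|\to\infty$ and $w(t)/\|w(t)\|\to v$. - $L$ has a minimizer over each ball $\{\|w\|\le R\}$, $R>0$, and for every choice $w_R$ of such minimizers $w_R/R\to v$ as $R\to\infty$. A two-class classifier $W=[w_1,w_2]$ assigns to $x\in\mathbb R^d$ the first class if $(w_1-w_2)^Tx>0$ and the second if $(w_1-w_2)^Tx<0$; a binary classifier $w$ assigns the first class ($\upsilon=1$) if $w^Tx>0$ and the second ($\upsilon=-1$) if $w^Tx<0$. Then minimizing each of the four losses produces a classifier, and: 1. the classifiers produced by $L_{\mathrm{LDT}}$ and $L_{\mathrm{VS}}$ have the same classification rule (and the same decision boundary); 2.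 for all $\delta_1,\delta_2>0$, the classifiers produced by $L_{\mathrm{CDT}}$ and $L_{\mathrm{CE}}$ have the same classification rule (and the same decision boundary). More precisely, each of the max-margin problems $$\min_W\|W\|_F^2\ \text{ s.t. }(\delta_{y_i}w_{y_i}-\delta_cw_c)^Th_i\ge1\ (c\ne y_i),\qquad \min_W\|W\|_F^2\ \text{ s.t. }\delta_{y_i}(w_{y_i}-w_c)^Th_i\ge1\ (c\ne y_i),$$ $$\min_w\|w\|^2\ \text{ s.t. }\upsilon_iw^Th_i\ge1,\qquad \min_w\|w\|^2\ \text{ s.t. }\upsilon_i\delta_{y_i}w^Th_i\ge1$$ (constraints for all $i$) has a unique solution, $W^{\mathrm{CDT}},W^{\mathrm{LDT}},w^{\mathrm{CE}},w^{\mathrm{VS}}$ respectively; the classifiers produced by $L_{\mathrm{CDT}},L_{\mathrm{LDT}},L_{\mathrm{CE}},L_{\mathrm{VS}}$ are these solutions divided by their norms; and $$W^{\mathrm{LDT}}=\big[\tfrac12w^{\mathrm{VS}},\,-\tfrac12w^{\mathrm{VS}}\big],\qquad W^{\mathrm{CDT}}=\Big[\tfrac{\delta_1}{\delta_1^2+\delta_2^2}w^{\mathrm{CE}},\,-\tfrac{\delta_2}{\delta_1^2+\delta_2^2}w^{\mathrm{CE}}\Big].$$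 -/

import Mathlib

open scoped InnerProductSpace

noncomputable section

/-- Feature vectors, with the Euclidean norm. -/
abbrev Feat (d : ℕ) : Type := EuclideanSpace ℝ (Fin d)

/-- Linear `k`-class classifiers: matrices `W = [w₁, …, w_k]` in `ℝ^{d × k}` given by their columns
`W c`, with the Frobenius norm and inner product. -/
abbrev Classifier (d k : ℕ) : Type := PiLp 2 (fun _ : Fin k => Feat d)

/-- The `±1` encoding of the two classes: class `1` (index `0`) is `+1`, class `2` (index `1`)
is `-1`. -/
def signLabel (c : Fin 2) : ℝ := if c = 0 then 1 else -1

/-! ### Training losses (no regularization) -/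

/-- The class-dependent-temperature (CDT) loss of a linear `k`-class model. -/
def cdtLoss {d k n : ℕ} (δ : Fin k → ℝ) (h : Fin n → Feat d) (y : Fin n → Fin k)
    (W : Classifier d k) : ℝ :=
  ∑ i, Real.log (1 + ∑ c ∈ Finset.univ.erase (y i),
    Real.exp (-⟪δ (y i) • W (y i) - δ c • W c, h i⟫_ℝ))

/-- The label-dependent-temperature (LDT) loss of a linear `k`-class model. -/
def ldtLoss {d k n : ℕ} (δ : Fin k → ℝ) (h : Fin n → Feat d) (y : Fin n → Fin k)
    (W : Classifier d k) : ℝ :=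
  ∑ i, Real.log (1 + ∑ c ∈ Finset.univ.erase (y i),
    Real.exp (-(δ (y i) * ⟪W (y i) - W c, h i⟫_ℝ)))

/-- The binary cross-entropy (logistic) loss. -/
def ceLoss {d n : ℕ} (h : Fin n → Feat d) (y : Fin n → Fin 2) (w : Feat d) : ℝ :=
  ∑ i, Real.log (1 + Real.exp (-(signLabel (y i) * ⟪w, h i⟫_ℝ)))

/-- The binary vector-scaling (VS) loss with multiplicative parameters `δ`, additive parameters
`ι` and class weights `ω`; the purely multiplicative loss is the case `ι = 0`, `ω = 1`. -/
def vsLoss {d n : ℕ} (δ ι ω : Fin 2 → ℝ) (h : Fin n → Feat d) (y : Fin n → Fin 2)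
    (w : Feat d) : ℝ :=
  ∑ i, ω (y i) * Real.log (1 + Real.exp (ι (y i)) *
    Real.exp (-(signLabel (y i) * δ (y i) * ⟪w, h i⟫_ℝ)))

/-! ### Minimizing an unregularized loss

On separable data the infimum of these losses is not attained, and what the minimization returns
is a direction. -/

section Minimization

variable {E : Type*} [NormedAddCommGroup E] [InnerProductSpace ℝ E] [CompleteSpace E]

/-- Gradient descent on `L` with constant step size `η`, started at `w₀`. -/
def gdIter (L : E → ℝ) (η : ℝ) (w₀ : E) : ℕ → E
  | 0 => w₀
  | t + 1 => gdIter L η w₀ t - η • gradient L (gdIter L η w₀ t)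

/-- The usual step-size condition: `0 < η < 2 / K` for a Lipschitz constant `K` of the gradient. -/
def AdmissibleStep (L : E → ℝ) (η : ℝ) : Prop :=
  0 < η ∧ ∃ K : NNReal, LipschitzWith K (gradient L) ∧ η * K < 2

/-- Admissible step sizes exist, and from every starting point and for every admissible step size,
gradient descent drives `L` to its infimum, diverges in norm, and converges in direction to `v`. -/
def IsGDDirection (L : E → ℝ) (v : E) : Prop :=
  (∃ η, AdmissibleStep L η) ∧
  ∀ (η : ℝ) (w₀ : E), AdmissibleStep L η →
    Filter.Tendsto (fun t => L (gdIter L η w₀ t)) Filter.atTop (nhds (⨅ w, L w)) ∧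
    Filter.Tendsto (fun t => ‖gdIter L η w₀ t‖) Filter.atTop Filter.atTop ∧
    Filter.Tendsto (fun t => ‖gdIter L η w₀ t‖⁻¹ • gdIter L η w₀ t) Filter.atTop (nhds v)

/-- `w` minimizes `L` over the ball of radius `R`. -/
def IsBallMin (L : E → ℝ) (R : ℝ) (w : E) : Prop :=
  w ∈ Metric.closedBall (0 : E) R ∧ IsMinOn L (Metric.closedBall (0 : E) R) w

/-- Minimizers of `L` over balls exist, and, scaled by the radius, they converge to `v` as the
norm constraint is lifted (`R → ∞`), however they are selected. -/
def IsPathDirection (L : E → ℝ) (v : E) : Prop :=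
  (∀ R : ℝ, 0 < R → ∃ w, IsBallMin L R w) ∧
  ∀ w : ℝ → E, (∀ R : ℝ, 0 < R → IsBallMin L R (w R)) →
    Filter.Tendsto (fun R : ℝ => R⁻¹ • w R) Filter.atTop (nhds v)

/-- `v` is the (unit-norm) classifier that minimizing `L` without regularization produces: the
limit direction both of gradient descent and of norm-constrained minimization. -/
def IsTrained (L : E → ℝ) (v : E) : Prop :=
  IsGDDirection L v ∧ IsPathDirection L v

/-- `w` is a minimum-norm point of the feasible set `S`. -/
def IsMinNorm (S : Set E) (w : E) : Prop :=
  w ∈ S ∧ ∀ v ∈ S, ‖w‖ ^ 2 ≤ ‖v‖ ^ 2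

end Minimization

/-! ### Feasible sets of the max-margin problems -/

def cdtFeasible {d k n : ℕ} (δ : Fin k → ℝ) (h : Fin n → Feat d) (y : Fin n → Fin k) :
    Set (Classifier d k) :=
  {W | ∀ i, ∀ c, c ≠ y i → 1 ≤ ⟪δ (y i) • W (y i) - δ c • W c, h i⟫_ℝ}

def ldtFeasible {d k n : ℕ} (δ : Fin k → ℝ) (h : Fin n → Feat d) (y : Fin n → Fin k) :
    Set (Classifier d k) :=
  {W | ∀ i, ∀ c, c ≠ y i → 1 ≤ δ (y i) * ⟪W (y i) - W c, h i⟫_ℝ}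

def ceFeasible {d n : ℕ} (h : Fin n → Feat d) (y : Fin n → Fin 2) : Set (Feat d) :=
  {w | ∀ i, 1 ≤ signLabel (y i) * ⟪w, h i⟫_ℝ}

def vsFeasible {d n : ℕ} (δ : Fin 2 → ℝ) (h : Fin n → Feat d) (y : Fin n → Fin 2) :
    Set (Feat d) :=
  {w | ∀ i, 1 ≤ signLabel (y i) * δ (y i) * ⟪w, h i⟫_ℝ}

/-! ### Classification rules -/

/-- Rule of a binary classifier: `1` (first class), `-1` (second class), `0` on the decision
boundary. -/
def binaryRule {d : ℕ} (w x : Feat d) : SignType := SignType.sign ⟪w, x⟫_ℝ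

/-- Rule of a two-class classifier `W = [w₁, w₂]`: the sign of `(w₁ - w₂)ᵀ x`. -/
def twoClassRule {d : ℕ} (W : Classifier d 2) (x : Feat d) : SignType :=
  SignType.sign ⟪W 0 - W 1, x⟫_ℝ

/-- Linear separability of the two classes (by a hyperplane through the origin). -/
def Separable {d n : ℕ} (h : Fin n → Feat d) (y : Fin n → Fin 2) : Prop :=
  ∃ w : Feat d, ∀ i, 0 < signLabel (y i) * ⟪w, h i⟫_ℝ

end

/-! With two classes, each of the four losses has the form `logitLoss`, `∑ aᵢ log (1 + exp (bᵢ - ⟪w,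
xᵢ⟫))` with `aᵢ > 0`. One theorem, `isTrained_logitLoss`, therefore covers them all: training yields
the direction of the minimum-norm point `v` of `marginSet x`.

Where such a loss `L` is small, `-log L` is the smallest margin up to a bounded error, so weights
and offsets do not influence the direction. The best margin on the unit ball is `1/‖v‖`, and vectors
of nearly best margin are close to `v/‖v‖`. Hence it suffices that `log L ≤ C - m r` for every `m <
1/‖v‖`, where `r` is the norm or radius (`IsMinNorm.tendsto_direction_of_log_logitLoss_le`). Ball
minimizers satisfy this by comparison with `R v/‖v‖`. Along gradient descent the gradient tends to
zero; pairing it with `v` shows that all sigmoid weights vanish, so `L → 0`. Eventually `L ≤ (1 +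
o(1)) ‖v‖ ‖∇L‖`, while a step lowers `L` by `(1 - o(1)) η ‖∇L‖²`. So `log L` drops by at least `m`
times the step length, and the triangle inequality sums these drops.

LDT constraints are VS constraints on `W 0 - W 1`; CDT constraints are CE constraints on `δ 0 • W 0
- δ 1 • W 1`. By Cauchy–Schwarz (`IsMinNorm.classifier`) the shortest preimage of `w` under `W ↦ p W
0 - q W 1` is `(p w, -q w)/(p² + q²)`. For `p, q > 0` its column difference is a positive multiple
of `w`, so the rules agree. -/

open Filter Topology

/-! ### The softplus function -/

section Softplus

theorem log_one_add_exp_pos (s : ℝ) : 0 < Real.log (1 + Real.exp s) :=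
  Real.log_pos (by linarith [Real.exp_pos s])

theorem log_one_add_exp_le_exp (s : ℝ) : Real.log (1 + Real.exp s) ≤ Real.exp s := by
  have := Real.log_le_sub_one_of_pos (by positivity : 0 < 1 + Real.exp s)
  linarith

theorem one_add_exp_mul_sigmoid (s : ℝ) : (1 + Real.exp s) * Real.sigmoid s = Real.exp s := by
  rw [Real.sigmoid_def, Real.exp_neg]
  field_simp
  ring

/-- Tangent line of `log` at `1 + exp s`. Keeping the factor `sigmoid s` makes the second-order
error of a gradient step proportional to `logitWeight`. -/
theorem log_one_add_exp_add_le (s r : ℝ) :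
    Real.log (1 + Real.exp (s + r)) ≤
      Real.log (1 + Real.exp s) + Real.sigmoid s * (Real.exp r - 1) := by
  have hs := Real.exp_pos s
  have hsr := Real.exp_pos (s + r)
  have h1 : (1 + Real.exp (s + r)) / (1 + Real.exp s) - 1 = Real.sigmoid s * (Real.exp r - 1) := by
    have := one_add_exp_mul_sigmoid s
    rw [Real.exp_add]
    field_simp
    linear_combination (1 - Real.exp r) * this
  have h2 := Real.log_le_sub_one_of_pos
    (by positivity : 0 < (1 + Real.exp (s + r)) / (1 + Real.exp s))
  rw [Real.log_div (by positivity) (by positivity)] at h2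
  linarith

/-- The softplus function decays at most exponentially: where it is at most `1`, its logarithm is
at least the argument, up to a constant. -/
theorem le_log_two_add_log_of_log_one_add_exp_le {s c : ℝ}
    (h : Real.log (1 + Real.exp s) ≤ c) (hc : c ≤ 1) : s ≤ Real.log 2 + Real.log c := by
  have hpos := (log_one_add_exp_pos s).trans_le h
  rw [← Real.log_mul (by norm_num) hpos.ne', Real.le_log_iff_exp_le (by positivity)]
  have h1 := Real.exp_le_exp.2 h
  rw [Real.exp_log (by positivity)] at h1
  -- For `|c| ≤ 1`, `exp c - 1 ≤ c + c² ≤ 2c`.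
  have h2 := (abs_le.1 (Real.abs_exp_sub_one_sub_id_le (abs_le.2 ⟨by linarith, hc⟩))).2
  nlinarith

theorem hasDerivAt_log_one_add_exp (s : ℝ) :
    HasDerivAt (fun s => Real.log (1 + Real.exp s)) (Real.sigmoid s) s := by
  have h := ((Real.hasDerivAt_exp s).const_add 1).log (by positivity)
  convert h using 1
  rw [eq_div_iff (by positivity), mul_comm, one_add_exp_mul_sigmoid]

theorem lipschitzWith_sigmoid : LipschitzWith 1 Real.sigmoid := by
  refine lipschitzWith_of_nnnorm_deriv_le differentiable_sigmoid fun s => ?_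
  rw [← NNReal.coe_le_coe, coe_nnnorm, Real.deriv_sigmoid, Real.norm_eq_abs, NNReal.coe_one,
    abs_le]
  have h0 := Real.sigmoid_pos s
  have h1 := Real.sigmoid_lt_one s
  constructor <;> nlinarith

end Softplus

/-! ### Gradient descent on a function with Lipschitz gradient -/

section Descent

variable {E : Type*} [NormedAddCommGroup E] [InnerProductSpace ℝ E] [CompleteSpace E]

/-- The descent lemma: on the segment, `L` minus its quadratic majorant has derivative `≤ 0`, by
Cauchy–Schwarz and the Lipschitz bound. -/
theorem LipschitzWith.le_add_inner_gradient {L : E → ℝ} (hL : Differentiable ℝ L) {K : NNReal}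
    (hK : LipschitzWith K (gradient L)) (w z : E) :
    L (w + z) ≤ L w + ⟪gradient L w, z⟫_ℝ + K / 2 * ‖z‖ ^ 2 := by
  have hd : ∀ s : ℝ, HasDerivAt (fun s : ℝ => L (w + s • z)) ⟪gradient L (w + s • z), z⟫_ℝ s := by
    intro s
    have h1 : HasDerivAt (fun s : ℝ => w + s • z) z s := by
      simpa using ((hasDerivAt_id s).smul_const z).const_add w
    have h2 := ((hL (w + s • z)).hasGradientAt).hasFDerivAt
    exact h2.comp_hasDerivAt s h1
  let F : ℝ → ℝ := fun s => L (w + s • z) - (s * ⟪gradient L w, z⟫_ℝ + K / 2 * s ^ 2 * ‖z‖ ^ 2)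
  have hF : ∀ s : ℝ, HasDerivAt F (⟪gradient L (w + s • z), z⟫_ℝ -
      (⟪gradient L w, z⟫_ℝ + K * s * ‖z‖ ^ 2)) s := by
    intro s
    have h1 := ((hasDerivAt_id s).mul_const ⟪gradient L w, z⟫_ℝ).add
      ((((hasDerivAt_id s).pow 2).const_mul ((K : ℝ) / 2)).mul_const (‖z‖ ^ 2))
    refine ((hd s).sub h1).congr_deriv ?_
    simp only [id]
    ring
  have hanti : AntitoneOn F (Set.Icc 0 1) := by
    refine antitoneOn_of_deriv_nonpos (convex_Icc 0 1)
      (fun s _ => (hF s).continuousAt.continuousWithinAt)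
      (fun s _ => (hF s).differentiableAt.differentiableWithinAt) fun s hs => ?_
    rw [interior_Icc] at hs
    rw [(hF s).deriv]
    have h1 := hK.dist_le_mul (w + s • z) w
    rw [dist_eq_norm, dist_eq_norm, add_sub_cancel_left, norm_smul, Real.norm_eq_abs,
      abs_of_pos hs.1] at h1
    have h2 := real_inner_le_norm (gradient L (w + s • z) - gradient L w) z
    rw [inner_sub_left] at h2
    have h3 := mul_le_mul_of_nonneg_right h1 (norm_nonneg z)
    nlinarith
  have h := hanti (Set.left_mem_Icc.2 zero_le_one) (Set.right_mem_Icc.2 zero_le_one) zero_le_one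
  simp only [F, one_smul, zero_smul, add_zero] at h
  linarith

/-- Along gradient descent with an admissible step size the gradients of a function bounded below
tend to zero. -/
theorem tendsto_gradient_gdIter {L : E → ℝ} (hL : Differentiable ℝ L) {B : ℝ} (hB : ∀ w, B ≤ L w)
    {η : ℝ} (hη : AdmissibleStep L η) (w₀ : E) :
    Tendsto (fun t => gradient L (gdIter L η w₀ t)) atTop (𝓝 0) := by
  obtain ⟨hη0, K, hK, hηK⟩ := hη
  let w := gdIter L η w₀
  -- The factor left by the descent lemma at `z = -η ∇L`; its positivity is the condition `η K < 2`.
  have hc : 0 < η * (1 - η * K / 2) := mul_pos hη0 (by linarith)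
  have hstep : ∀ t, η * (1 - η * K / 2) * ‖gradient L (w t)‖ ^ 2 ≤ L (w t) - L (w (t + 1)) := by
    intro t
    have h := hK.le_add_inner_gradient hL (w t) (-(η • gradient L (w t)))
    rw [← sub_eq_add_neg, inner_neg_right, inner_smul_right, real_inner_self_eq_norm_sq, norm_neg,
      norm_smul, Real.norm_eq_abs, abs_of_pos hη0] at h
    change L (w (t + 1)) ≤ _ at h
    nlinarith
  have hsum : Summable fun t => η * (1 - η * K / 2) * ‖gradient L (w t)‖ ^ 2 := by
    refine summable_of_sum_range_le (c := L (w 0) - B) (fun t => by positivity) fun T => ?_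
    refine (Finset.sum_le_sum fun t _ => hstep t).trans ?_
    rw [Finset.sum_range_sub']
    linarith [hB (w T)]
  have h0 := ((summable_mul_left_iff hc.ne').1 hsum).tendsto_atTop_zero
  rw [tendsto_zero_iff_norm_tendsto_zero]
  simpa [Real.sqrt_sq, w] using h0.sqrt

end Descent

/-! ### Minimum-norm points -/

section MinNorm

theorem isMinNorm_iff_norm_eq_iInf {E : Type*} [NormedAddCommGroup E] {S : Set E} {w : E} (hw : w ∈ S) :
    IsMinNorm S w ↔ ‖(0 : E) - w‖ = ⨅ v : S, ‖(0 : E) - v‖ := by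
  simp only [zero_sub, norm_neg]
  have hbdd : BddBelow (Set.range fun v : S => ‖(v : E)‖) :=
    ⟨0, by rintro _ ⟨v, rfl⟩; exact norm_nonneg _⟩
  have : Nonempty S := ⟨⟨w, hw⟩⟩
  constructor
  · rintro ⟨_, h⟩
    refine le_antisymm (le_ciInf fun v => ?_) (ciInf_le hbdd ⟨w, hw⟩)
    exact (sq_le_sq₀ (norm_nonneg _) (norm_nonneg _)).1 (h v v.2)
  · intro h
    refine ⟨hw, fun v hv => ?_⟩
    have := ciInf_le hbdd ⟨v, hv⟩
    rw [← h] at this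
    gcongr

variable {E : Type*} [NormedAddCommGroup E] [InnerProductSpace ℝ E]

/-- The variational inequality for the projection of `0` onto a convex set. -/
theorem Convex.isMinNorm_iff {S : Set E} (hS : Convex ℝ S) {w : E} (hw : w ∈ S) :
    IsMinNorm S w ↔ ∀ v ∈ S, ‖w‖ ^ 2 ≤ ⟪w, v⟫_ℝ := by
  rw [isMinNorm_iff_norm_eq_iInf hw, norm_eq_iInf_iff_real_inner_le_zero hS hw]
  refine forall₂_congr fun v _ => ?_
  rw [zero_sub, inner_neg_left, inner_sub_right, real_inner_self_eq_norm_sq]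
  constructor <;> intro h <;> linarith

theorem IsMinNorm.unique {S : Set E} (hS : Convex ℝ S) {v w : E} (hv : IsMinNorm S v)
    (hw : IsMinNorm S w) : v = w := by
  have h1 := (hS.isMinNorm_iff hv.1).1 hv w hw.1
  have h2 := hw.2 v hv.1
  have h3 := norm_sub_sq_real v w
  have h4 : ‖v - w‖ ^ 2 ≤ 0 := by linarith
  rw [← sub_eq_zero, ← norm_eq_zero]
  exact pow_eq_zero_iff two_ne_zero |>.1 (le_antisymm h4 (sq_nonneg _))

theorem IsMinNorm.iff_eq {S : Set E} (hS : Convex ℝ S) {w : E} (hw : IsMinNorm S w) (v : E) :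
    IsMinNorm S v ↔ v = w :=
  ⟨fun hv => hv.unique hS hw, fun h => h ▸ hw⟩

/-- The vectors having margin at least one against each `x i`. -/
def marginSet {κ : Type*} (x : κ → E) : Set E := {w | ∀ i, 1 ≤ ⟪w, x i⟫_ℝ}

variable {κ : Type*} {x : κ → E}

theorem convex_marginSet (x : κ → E) : Convex ℝ (marginSet x) := by
  intro v hv w hw a b ha hb hab i
  rw [inner_add_left, real_inner_smul_left, real_inner_smul_left]
  nlinarith [hv i, hw i]

theorem isClosed_marginSet (x : κ → E) : IsClosed (marginSet x) := by
  simp only [marginSet, Set.ofPred_forall]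
  exact isClosed_iInter fun i => isClosed_le continuous_const (by fun_prop)

theorem exists_isMinNorm_marginSet [CompleteSpace E] [Finite κ] {w : E}
    (hw : ∀ i, 0 < ⟪w, x i⟫_ℝ) : ∃ v, IsMinNorm (marginSet x) v := by
  have hne : (marginSet x).Nonempty := by
    cases nonempty_fintype κ
    -- The sum dominates each inverse margin, so this multiple of `w` has all margins at least one.
    refine ⟨(∑ i, (⟪w, x i⟫_ℝ)⁻¹) • w, fun i => ?_⟩
    rw [real_inner_smul_left]
    have h := Finset.single_le_sum (f := fun j => (⟪w, x j⟫_ℝ)⁻¹)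
      (fun j _ => (inv_pos.2 (hw j)).le) (Finset.mem_univ i)
    calc (1 : ℝ) = (⟪w, x i⟫_ℝ)⁻¹ * ⟪w, x i⟫_ℝ := (inv_mul_cancel₀ (hw i).ne').symm
      _ ≤ _ := mul_le_mul_of_nonneg_right h (hw i).le
  obtain ⟨v, hv, h⟩ := exists_norm_eq_iInf_of_complete_convex hne (isClosed_marginSet x).isComplete
    (convex_marginSet x) 0
  exact ⟨v, (isMinNorm_iff_norm_eq_iInf hv).2 h⟩

theorem IsMinNorm.norm_pos [Nonempty κ] {w : E} (hw : IsMinNorm (marginSet x) w) : 0 < ‖w‖ := by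
  rw [norm_pos_iff]
  rintro rfl
  have := hw.1 (Classical.arbitrary κ)
  rw [inner_zero_left] at this
  linarith

/-- A vector of margin `m` correlates with the minimum-norm vector of unit margin. -/
theorem IsMinNorm.mul_sq_le_inner {w v : E} (hw : IsMinNorm (marginSet x) w) {m : ℝ} (hm : 0 < m)
    (hv : ∀ i, m ≤ ⟪v, x i⟫_ℝ) : m * ‖w‖ ^ 2 ≤ ⟪w, v⟫_ℝ := by
  have hmem : m⁻¹ • v ∈ marginSet x := fun i => by
    rw [real_inner_smul_left, ← inv_mul_cancel₀ hm.ne']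
    exact mul_le_mul_of_nonneg_left (hv i) (inv_pos.2 hm).le
  have h := ((convex_marginSet x).isMinNorm_iff hw.1).1 hw _ hmem
  rw [inner_smul_right] at h
  calc m * ‖w‖ ^ 2 ≤ m * (m⁻¹ * ⟪w, v⟫_ℝ) := mul_le_mul_of_nonneg_left h hm.le
    _ = _ := by field_simp

/-- Vectors in the unit ball whose margins approach the optimal one converge to the direction of
the max-margin solution. -/
theorem IsMinNorm.tendsto_direction [Nonempty κ] {w : E} (hw : IsMinNorm (marginSet x) w)
    {α : Type*} {l : Filter α} {v : α → E} (hv : ∀ᶠ t in l, ‖v t‖ ≤ 1)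
    (hm : ∀ m < ‖w‖⁻¹, ∀ᶠ t in l, ∀ i, m ≤ ⟪v t, x i⟫_ℝ) :
    Tendsto v l (𝓝 (‖w‖⁻¹ • w)) := by
  have hpos := hw.norm_pos
  rw [Metric.tendsto_nhds]
  intro ε hε
  -- A margin `m > 0` gives squared distance at most `2 - 2 m ‖w‖`, which is below `ε²` for this
  -- choice of `m`.
  obtain ⟨m, hm1, hm2⟩ : ∃ m, max 0 (‖w‖⁻¹ * (1 - ε ^ 2 / 2)) < m ∧ m < ‖w‖⁻¹ := by
    refine exists_between (max_lt (inv_pos.2 hpos) ?_)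
    nlinarith [inv_pos.2 hpos, mul_pos (inv_pos.2 hpos) (pow_pos hε 2)]
  rw [max_lt_iff] at hm1
  filter_upwards [hv, hm m hm2] with t ht1 ht2
  have h1 := hw.mul_sq_le_inner hm1.1 ht2
  have h2 := norm_sub_sq_real (v t) (‖w‖⁻¹ • w)
  have h3 : ‖‖w‖⁻¹ • w‖ = 1 := by
    rw [norm_smul, norm_inv, norm_norm, inv_mul_cancel₀ hpos.ne']
  rw [h3, inner_smul_right, real_inner_comm] at h2
  have h4 : m * ‖w‖ ≤ ‖w‖⁻¹ * ⟪w, v t⟫_ℝ := by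
    rw [le_inv_mul_iff₀ hpos]
    linarith
  have h5 : 1 - ε ^ 2 / 2 < m * ‖w‖ := by
    have := hm1.2
    rwa [inv_mul_lt_iff₀ hpos, mul_comm] at this
  rw [dist_eq_norm]
  refine lt_of_pow_lt_pow_left₀ 2 hε.le ?_
  have h6 : ‖v t‖ ^ 2 ≤ 1 := pow_le_one₀ (norm_nonneg _) ht1
  linarith

end MinNorm

/-! ### Weighted logistic losses -/

section LogitLoss

variable {E : Type*} [NormedAddCommGroup E] [InnerProductSpace ℝ E] {κ : Type*} [Fintype κ]

/-- The logistic loss with weights `a` and offsets `b` of the linear model with signed features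
`x`. -/
noncomputable def logitLoss (a b : κ → ℝ) (x : κ → E) (w : E) : ℝ :=
  ∑ i, a i * Real.log (1 + Real.exp (b i - ⟪w, x i⟫_ℝ))

/-- The total weight of the features in the gradient of `logitLoss`. -/
noncomputable def logitWeight (a b : κ → ℝ) (x : κ → E) (w : E) : ℝ :=
  ∑ i, a i * Real.sigmoid (b i - ⟪w, x i⟫_ℝ)

variable {a b : κ → ℝ} {x : κ → E}

theorem logitLoss_pos [Nonempty κ] (ha : ∀ i, 0 < a i) (w : E) : 0 < logitLoss a b x w :=
  Finset.sum_pos (fun i _ => mul_pos (ha i) (log_one_add_exp_pos _)) Finset.univ_nonempty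

theorem term_le_logitLoss (ha : ∀ i, 0 < a i) (w : E) (i : κ) :
    a i * Real.log (1 + Real.exp (b i - ⟪w, x i⟫_ℝ)) ≤ logitLoss a b x w :=
  Finset.single_le_sum (f := fun i => a i * Real.log (1 + Real.exp (b i - ⟪w, x i⟫_ℝ)))
    (fun j _ => (mul_pos (ha j) (log_one_add_exp_pos _)).le) (Finset.mem_univ i)

theorem term_le_logitWeight (ha : ∀ i, 0 < a i) (w : E) (i : κ) :
    a i * Real.sigmoid (b i - ⟪w, x i⟫_ℝ) ≤ logitWeight a b x w :=
  Finset.single_le_sum (f := fun i => a i * Real.sigmoid (b i - ⟪w, x i⟫_ℝ))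
    (fun j _ => (mul_pos (ha j) (Real.sigmoid_pos _)).le) (Finset.mem_univ i)

theorem logitWeight_nonneg (ha : ∀ i, 0 < a i) (w : E) : 0 ≤ logitWeight a b x w :=
  Finset.sum_nonneg fun i _ => (mul_pos (ha i) (Real.sigmoid_pos _)).le

/-- Termwise, `log (1 + exp s) ≤ exp s = (1 + exp s) * sigmoid s`. The constant `c` can be taken
small once all margins are large. -/
theorem logitLoss_le_mul_logitWeight (ha : ∀ i, 0 < a i) {w : E} {c : ℝ}
    (hc : ∀ i, Real.exp (b i - ⟪w, x i⟫_ℝ) ≤ c) :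
    logitLoss a b x w ≤ (1 + c) * logitWeight a b x w := by
  rw [logitLoss, logitWeight, Finset.mul_sum]
  refine Finset.sum_le_sum fun i _ => ?_
  have h1 := log_one_add_exp_le_exp (b i - ⟪w, x i⟫_ℝ)
  have h0 := one_add_exp_mul_sigmoid (b i - ⟪w, x i⟫_ℝ)
  have h2 : (1 + Real.exp (b i - ⟪w, x i⟫_ℝ)) * Real.sigmoid (b i - ⟪w, x i⟫_ℝ) ≤
      (1 + c) * Real.sigmoid (b i - ⟪w, x i⟫_ℝ) :=
    mul_le_mul_of_nonneg_right (by linarith [hc i]) (Real.sigmoid_nonneg _)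
  calc _ ≤ a i * ((1 + c) * Real.sigmoid (b i - ⟪w, x i⟫_ℝ)) :=
        mul_le_mul_of_nonneg_left (h1.trans (h0.symm.trans_le h2)) (ha i).le
    _ = _ := by ring

/-- A small loss forces large margins. -/
theorem sub_log_logitLoss_le_inner [Nonempty κ] (ha : ∀ i, 0 < a i) {w : E} {i : κ}
    (h : logitLoss a b x w ≤ a i) :
    b i + Real.log (a i) - Real.log 2 - Real.log (logitLoss a b x w) ≤ ⟪w, x i⟫_ℝ := by
  have hL := logitLoss_pos (b := b) (x := x) ha w
  have h1 : Real.log (1 + Real.exp (b i - ⟪w, x i⟫_ℝ)) ≤ logitLoss a b x w / a i := by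
    rw [le_div_iff₀ (ha i), mul_comm]
    exact term_le_logitLoss ha w i
  have h2 := le_log_two_add_log_of_log_one_add_exp_le h1 ((div_le_one (ha i)).2 h)
  rw [Real.log_div hL.ne' (ha i).ne'] at h2
  linarith

theorem logitLoss_le_exp (ha : ∀ i, 0 < a i) {w : E} {m : ℝ} (hm : ∀ i, m ≤ ⟪w, x i⟫_ℝ) :
    logitLoss a b x w ≤ (∑ i, a i * Real.exp (b i)) * Real.exp (-m) := by
  rw [logitLoss, Finset.sum_mul]
  refine Finset.sum_le_sum fun i _ => ?_
  rw [mul_assoc, ← Real.exp_add]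
  refine mul_le_mul_of_nonneg_left ((log_one_add_exp_le_exp _).trans ?_) (ha i).le
  exact Real.exp_le_exp.2 (by linarith [hm i])

theorem hasGradientAt_logitLoss [CompleteSpace E] (a b : κ → ℝ) (x : κ → E) (w : E) :
    HasGradientAt (logitLoss a b x)
      (-∑ i, (a i * Real.sigmoid (b i - ⟪w, x i⟫_ℝ)) • x i) w := by
  rw [hasGradientAt_iff_hasFDerivAt]
  have h : ∀ i ∈ (Finset.univ : Finset κ),
      HasFDerivAt (fun w => a i * Real.log (1 + Real.exp (b i - ⟪w, x i⟫_ℝ)))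
        (a i • (Real.sigmoid (b i - ⟪w, x i⟫_ℝ) • -(innerSL ℝ (x i)))) w := by
    intro i _
    have h1 : HasFDerivAt (fun w : E => b i - ⟪w, x i⟫_ℝ) (-(innerSL ℝ (x i))) w := by
      have := ((innerSL ℝ (x i)).hasFDerivAt (x := w)).const_sub (b i)
      simpa only [innerSL_apply_apply, real_inner_comm] using this
    exact ((hasDerivAt_log_one_add_exp _).comp_hasFDerivAt w h1).const_mul (a i)
  refine (HasFDerivAt.fun_sum h).congr_fderiv ?_
  ext v
  simp [mul_assoc]

theorem gradient_logitLoss [CompleteSpace E] (a b : κ → ℝ) (x : κ → E) (w : E) :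
    gradient (logitLoss a b x) w = -∑ i, (a i * Real.sigmoid (b i - ⟪w, x i⟫_ℝ)) • x i :=
  (hasGradientAt_logitLoss a b x w).gradient

theorem differentiable_logitLoss [CompleteSpace E] (a b : κ → ℝ) (x : κ → E) :
    Differentiable ℝ (logitLoss a b x) :=
  fun w => (hasGradientAt_logitLoss a b x w).differentiableAt

theorem inner_gradient_logitLoss [CompleteSpace E] (a b : κ → ℝ) (x : κ → E) (w v : E) :
    ⟪gradient (logitLoss a b x) w, v⟫_ℝ =
      -∑ i, a i * Real.sigmoid (b i - ⟪w, x i⟫_ℝ) * ⟪v, x i⟫_ℝ := by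
  rw [real_inner_comm, gradient_logitLoss, inner_neg_right, inner_sum]
  simp only [inner_smul_right]

theorem exists_lipschitzWith_gradient_logitLoss [CompleteSpace E] (a b : κ → ℝ) (x : κ → E) :
    ∃ K, LipschitzWith K (gradient (logitLoss a b x)) := by
  refine ⟨∑ i, ‖a i‖₊ * ‖x i‖₊ * ‖x i‖₊, LipschitzWith.of_dist_le_mul fun v w => ?_⟩
  rw [dist_eq_norm, dist_eq_norm, gradient_logitLoss, gradient_logitLoss, neg_sub_neg,
    ← Finset.sum_sub_distrib, NNReal.coe_sum, Finset.sum_mul]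
  refine (norm_sum_le _ _).trans (Finset.sum_le_sum fun i _ => ?_)
  rw [← sub_smul, ← mul_sub, norm_smul, norm_mul]
  have h1 := lipschitzWith_sigmoid.dist_le_mul (b i - ⟪w, x i⟫_ℝ) (b i - ⟪v, x i⟫_ℝ)
  rw [dist_eq_norm, dist_eq_norm, sub_sub_sub_cancel_left, ← inner_sub_left, NNReal.coe_one,
    one_mul] at h1
  have h2 := h1.trans (norm_inner_le_norm (v - w) (x i))
  push_cast
  calc _ ≤ ‖a i‖ * (‖v - w‖ * ‖x i‖) * ‖x i‖ := by gcongr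
    _ = _ := by ring

theorem exists_admissibleStep_logitLoss [CompleteSpace E] (a b : κ → ℝ) (x : κ → E) :
    ∃ η, AdmissibleStep (logitLoss a b x) η := by
  obtain ⟨K, hK⟩ := exists_lipschitzWith_gradient_logitLoss a b x
  -- The added `1` covers `K = 0`.
  refine ⟨(K + 1 : ℝ)⁻¹, by positivity, K, hK, ?_⟩
  rw [inv_mul_lt_iff₀ (by positivity)]
  linarith [K.coe_nonneg]

/-- Pair `-∇L`, a positive combination of the features, with `v`: every coefficient is counted at
least once. -/
theorem logitWeight_le_norm_gradient [CompleteSpace E] (ha : ∀ i, 0 < a i) {v : E}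
    (hv : v ∈ marginSet x) (w : E) :
    logitWeight a b x w ≤ ‖v‖ * ‖gradient (logitLoss a b x) w‖ := by
  have h1 := neg_le_of_abs_le (abs_real_inner_le_norm (gradient (logitLoss a b x) w) v)
  rw [inner_gradient_logitLoss] at h1
  have h2 : logitWeight a b x w ≤
      ∑ i, a i * Real.sigmoid (b i - ⟪w, x i⟫_ℝ) * ⟪v, x i⟫_ℝ :=
    Finset.sum_le_sum fun i _ =>
      le_mul_of_one_le_right (mul_pos (ha i) (Real.sigmoid_pos _)).le (hv i)
  linarith

/-- A descent estimate whose second-order term is small where the loss is small. -/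
theorem logitLoss_gradient_step_le [CompleteSpace E] (ha : ∀ i, 0 < a i) {M η : ℝ}
    (hM : ∀ i, ‖x i‖ ≤ M) (w : E)
    (hη : |η| * ‖gradient (logitLoss a b x) w‖ * M ≤ 1) :
    logitLoss a b x (w - η • gradient (logitLoss a b x) w) ≤
      logitLoss a b x w - η * (1 - η * M ^ 2 * logitWeight a b x w) *
        ‖gradient (logitLoss a b x) w‖ ^ 2 := by
  set g := gradient (logitLoss a b x) w with hg
  have hinner := inner_gradient_logitLoss a b x w g
  rw [← hg, real_inner_self_eq_norm_sq] at hinner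
  -- The exponent moves by `r = η ⟪g, x i⟫`, and `exp r - 1 ≤ r + r²` since `|r| ≤ 1`. After
  -- summation the linear terms give `-η ‖g‖²`.
  have hterm : ∀ i, a i * Real.log (1 + Real.exp (b i - ⟪w - η • g, x i⟫_ℝ)) ≤
      a i * Real.log (1 + Real.exp (b i - ⟪w, x i⟫_ℝ)) +
      η * (a i * Real.sigmoid (b i - ⟪w, x i⟫_ℝ) * ⟪g, x i⟫_ℝ) +
      η ^ 2 * M ^ 2 * ‖g‖ ^ 2 * (a i * Real.sigmoid (b i - ⟪w, x i⟫_ℝ)) := by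
    intro i
    have habs : |η * ⟪g, x i⟫_ℝ| ≤ |η| * ‖g‖ * M := by
      rw [abs_mul, mul_assoc]
      refine mul_le_mul_of_nonneg_left ?_ (abs_nonneg _)
      exact (abs_real_inner_le_norm _ _).trans
        (mul_le_mul_of_nonneg_left (hM i) (norm_nonneg _))
    have h1 := (abs_le.1 (Real.abs_exp_sub_one_sub_id_le (habs.trans hη))).2
    have h2 : (η * ⟪g, x i⟫_ℝ) ^ 2 ≤ η ^ 2 * M ^ 2 * ‖g‖ ^ 2 := by
      rw [← sq_abs]
      calc _ ≤ (|η| * ‖g‖ * M) ^ 2 := by gcongr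
        _ = |η| ^ 2 * M ^ 2 * ‖g‖ ^ 2 := by ring
        _ = _ := by rw [sq_abs]
    have h3 := log_one_add_exp_add_le (b i - ⟪w, x i⟫_ℝ) (η * ⟪g, x i⟫_ℝ)
    rw [inner_sub_left, real_inner_smul_left,
      show b i - (⟪w, x i⟫_ℝ - η * ⟪g, x i⟫_ℝ) = b i - ⟪w, x i⟫_ℝ + η * ⟪g, x i⟫_ℝ by ring]
    have h4 : Real.sigmoid (b i - ⟪w, x i⟫_ℝ) * (Real.exp (η * ⟪g, x i⟫_ℝ) - 1) ≤
        Real.sigmoid (b i - ⟪w, x i⟫_ℝ) * (η * ⟪g, x i⟫_ℝ + η ^ 2 * M ^ 2 * ‖g‖ ^ 2) :=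
      mul_le_mul_of_nonneg_left (by linarith) (Real.sigmoid_nonneg _)
    calc _ ≤ a i * (Real.log (1 + Real.exp (b i - ⟪w, x i⟫_ℝ)) +
          Real.sigmoid (b i - ⟪w, x i⟫_ℝ) * (η * ⟪g, x i⟫_ℝ + η ^ 2 * M ^ 2 * ‖g‖ ^ 2)) :=
          mul_le_mul_of_nonneg_left (by linarith) (ha i).le
      _ = _ := by ring
  have hsum := Finset.sum_le_sum fun i (_ : i ∈ Finset.univ) => hterm i
  rw [Finset.sum_add_distrib, Finset.sum_add_distrib, ← Finset.mul_sum, ← Finset.mul_sum] at hsum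
  change logitLoss a b x _ ≤ logitLoss a b x w + _ + _ * logitWeight a b x w at hsum
  refine hsum.trans (le_of_eq ?_)
  linear_combination η * hinner

end LogitLoss

/-! ### Directional convergence for logistic losses on separable data -/

section Direction

variable {E : Type*} [NormedAddCommGroup E] [InnerProductSpace ℝ E] {κ : Type*} [Fintype κ]
  [Nonempty κ] {a b : κ → ℝ} {x : κ → E} {v : E}

/-- If the loss decays at the optimal exponential rate in the norm, the direction tends to the
max-margin one. -/
theorem IsMinNorm.tendsto_direction_of_log_logitLoss_le (hv : IsMinNorm (marginSet x) v)
    (ha : ∀ i, 0 < a i) {α : Type*} {l : Filter α} {w : α → E} {r : α → ℝ}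
    (hr : Tendsto r l atTop) (hw : ∀ᶠ t in l, ‖w t‖ ≤ r t)
    (hlog : ∀ m < ‖v‖⁻¹, ∃ C, ∀ᶠ t in l, Real.log (logitLoss a b x (w t)) ≤ C - m * r t) :
    Tendsto (fun t => (r t)⁻¹ • w t) l (𝓝 (‖v‖⁻¹ • v)) := by
  refine hv.tendsto_direction ?_ fun m hm => ?_
  · filter_upwards [hw, hr.eventually_gt_atTop 0] with t ht ht0
    rw [norm_smul, norm_inv, Real.norm_eq_abs, abs_of_pos ht0, inv_mul_le_iff₀ ht0, mul_one]
    exact ht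
  -- The gap `(m' - m) * r t` absorbs all constants; `m' > 0` forces the loss below each `a i`.
  obtain ⟨m', h1, h2⟩ := exists_between (max_lt (inv_pos.2 hv.norm_pos) hm)
  rw [max_lt_iff] at h1
  obtain ⟨C, hC⟩ := hlog m' h2
  have hlarge : ∀ i, ∀ᶠ t in l, C - Real.log (a i) ≤ m' * r t :=
    fun i => (hr.const_mul_atTop h1.1).eventually_ge_atTop _
  have hmargin : ∀ i, ∀ᶠ t in l,
      C + Real.log 2 - b i - Real.log (a i) ≤ (m' - m) * r t :=
    fun i => (hr.const_mul_atTop (sub_pos.2 h1.2)).eventually_ge_atTop _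
  filter_upwards [hC, hr.eventually_gt_atTop 0, eventually_all.2 hlarge,
    eventually_all.2 hmargin] with t ht ht0 ht1 ht2 i
  have hle : logitLoss a b x (w t) ≤ a i := by
    rw [← Real.log_le_log_iff (logitLoss_pos ha _) (ha i)]
    linarith [ht1 i]
  have h3 := sub_log_logitLoss_le_inner ha hle
  rw [real_inner_smul_left, le_inv_mul_iff₀ ht0]
  linarith [ht2 i]

theorem isPathDirection_logitLoss [FiniteDimensional ℝ E] [CompleteSpace E]
    (hv : IsMinNorm (marginSet x) v) (ha : ∀ i, 0 < a i) :
    IsPathDirection (logitLoss a b x) (‖v‖⁻¹ • v) := by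
  have hpos := hv.norm_pos
  refine ⟨fun R hR => ?_, fun w hw => ?_⟩
  · have : ProperSpace E := FiniteDimensional.proper ℝ E
    exact (isCompact_closedBall (0 : E) R).exists_isMinOn
      ⟨0, Metric.mem_closedBall_self hR.le⟩
      (differentiable_logitLoss a b x).continuous.continuousOn
  · refine hv.tendsto_direction_of_log_logitLoss_le (b := b) ha (r := fun R => R) tendsto_id ?_
      fun m hm => ⟨Real.log (∑ i, a i * Real.exp (b i)), ?_⟩
    · filter_upwards [eventually_gt_atTop 0] with R hR
      exact mem_closedBall_zero_iff.1 (hw R hR).1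
    filter_upwards [eventually_gt_atTop 0] with R hR
    -- The competitor `R v/‖v‖` has all margins at least `R/‖v‖`.
    have hball : R • ‖v‖⁻¹ • v ∈ Metric.closedBall (0 : E) R := by
      rw [mem_closedBall_zero_iff, norm_smul, norm_smul, norm_inv, norm_norm,
        inv_mul_cancel₀ hpos.ne', mul_one, Real.norm_eq_abs, abs_of_pos hR]
    have h1 : logitLoss a b x (w R) ≤ logitLoss a b x (R • ‖v‖⁻¹ • v) := (hw R hR).2 hball
    have h2 : logitLoss a b x (R • ‖v‖⁻¹ • v) ≤
        (∑ i, a i * Real.exp (b i)) * Real.exp (-(m * R)) := by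
      refine logitLoss_le_exp ha fun i => ?_
      rw [real_inner_smul_left, real_inner_smul_left, mul_comm m]
      refine mul_le_mul_of_nonneg_left (hm.le.trans ?_) hR.le
      exact le_mul_of_one_le_right (inv_pos.2 hpos).le (hv.1 i)
    have hC : 0 < ∑ i, a i * Real.exp (b i) :=
      Finset.sum_pos (fun i _ => mul_pos (ha i) (Real.exp_pos _)) Finset.univ_nonempty
    have h3 := Real.log_le_log (logitLoss_pos ha _) (h1.trans h2)
    rw [Real.log_mul hC.ne' (Real.exp_ne_zero _), Real.log_exp] at h3
    linarith

variable [CompleteSpace E] {η : ℝ}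

theorem tendsto_logitWeight_gdIter (hv : v ∈ marginSet x) (ha : ∀ i, 0 < a i)
    (hη : AdmissibleStep (logitLoss a b x) η) (w₀ : E) :
    Tendsto (fun t => logitWeight a b x (gdIter (logitLoss a b x) η w₀ t)) atTop (𝓝 0) := by
  have hg := (tendsto_gradient_gdIter (differentiable_logitLoss a b x)
    (fun w => (logitLoss_pos ha w).le) hη w₀).norm.const_mul ‖v‖
  rw [norm_zero, mul_zero] at hg
  exact squeeze_zero (fun t => logitWeight_nonneg ha _)
    (fun t => logitWeight_le_norm_gradient ha hv _) hg

theorem tendsto_exp_sub_inner_gdIter (hv : v ∈ marginSet x) (ha : ∀ i, 0 < a i)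
    (hη : AdmissibleStep (logitLoss a b x) η) (w₀ : E) (i : κ) :
    Tendsto (fun t => Real.exp (b i - ⟪gdIter (logitLoss a b x) η w₀ t, x i⟫_ℝ)) atTop
      (𝓝 0) := by
  have hσ : Tendsto (fun t => Real.sigmoid (b i - ⟪gdIter (logitLoss a b x) η w₀ t, x i⟫_ℝ))
      atTop (𝓝 0) := by
    have h := (tendsto_logitWeight_gdIter hv ha hη w₀).const_mul (a i)⁻¹
    rw [mul_zero] at h
    refine squeeze_zero (fun t => Real.sigmoid_nonneg _) (fun t => ?_) h
    rw [le_inv_mul_iff₀ (ha i)]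
    exact term_le_logitWeight ha _ i
  -- `exp s = sigmoid s / (1 - sigmoid s)`.
  have h := hσ.div (hσ.const_sub 1) (by norm_num)
  rw [zero_div] at h
  refine h.congr fun t => ?_
  have h1 := Real.sigmoid_lt_one (b i - ⟪gdIter (logitLoss a b x) η w₀ t, x i⟫_ℝ)
  have h2 := one_add_exp_mul_sigmoid (b i - ⟪gdIter (logitLoss a b x) η w₀ t, x i⟫_ℝ)
  rw [Pi.div_apply, div_eq_iff (by linarith)]
  linarith

theorem tendsto_logitLoss_gdIter (hv : v ∈ marginSet x) (ha : ∀ i, 0 < a i)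
    (hη : AdmissibleStep (logitLoss a b x) η) (w₀ : E) :
    Tendsto (fun t => logitLoss a b x (gdIter (logitLoss a b x) η w₀ t)) atTop (𝓝 0) := by
  have h : ∀ i ∈ (Finset.univ : Finset κ), Tendsto (fun t => a i * Real.log (1 +
      Real.exp (b i - ⟪gdIter (logitLoss a b x) η w₀ t, x i⟫_ℝ))) atTop (𝓝 0) := by
    intro i _
    have h1 := (((tendsto_exp_sub_inner_gdIter hv ha hη w₀ i).const_add 1).log
      (by norm_num)).const_mul (a i)
    simpa using h1
  have hsum := tendsto_finsetSum Finset.univ h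
  rw [Finset.sum_const_zero] at hsum
  exact hsum

theorem tendsto_norm_gdIter_logitLoss (hv : v ∈ marginSet x) (ha : ∀ i, 0 < a i)
    (hη : AdmissibleStep (logitLoss a b x) η) (w₀ : E) :
    Tendsto (fun t => ‖gdIter (logitLoss a b x) η w₀ t‖) atTop atTop := by
  let i := Classical.arbitrary κ
  have hx : 0 < ‖x i‖ := by
    rw [norm_pos_iff]
    intro h0
    have := hv i
    rw [h0, inner_zero_right] at this
    linarith
  have h1 := Real.tendsto_exp_comp_nhds_zero.1 (tendsto_exp_sub_inner_gdIter hv ha hη w₀ i)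
  rw [← tendsto_mul_const_atTop_of_pos hx]
  refine tendsto_atTop_mono (fun t => real_inner_le_norm _ (x i)) ?_
  have h2 := tendsto_atTop_add_const_left atTop (b i) (tendsto_neg_atBot_atTop.comp h1)
  refine h2.congr fun t => ?_
  simp

/-- Below the optimal margin rate, the logarithm of the loss eventually decreases at least
proportionally to the length of each gradient step. -/
theorem eventually_log_logitLoss_gdIter_succ_le (hv : IsMinNorm (marginSet x) v)
    (ha : ∀ i, 0 < a i) (hη : AdmissibleStep (logitLoss a b x) η) (w₀ : E) {m : ℝ}
    (hm : m < ‖v‖⁻¹) :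
    ∀ᶠ t in atTop, Real.log (logitLoss a b x (gdIter (logitLoss a b x) η w₀ (t + 1))) ≤
      Real.log (logitLoss a b x (gdIter (logitLoss a b x) η w₀ t)) -
        m * ‖gdIter (logitLoss a b x) η w₀ (t + 1) - gdIter (logitLoss a b x) η w₀ t‖ := by
  have hpos := hv.norm_pos
  have hη0 := hη.1
  set w := gdIter (logitLoss a b x) η w₀
  obtain ⟨M, hM⟩ : ∃ M, ∀ i, ‖x i‖ ≤ M :=
    ⟨∑ i, ‖x i‖, fun i => Finset.single_le_sum (f := fun i => ‖x i‖)
      (fun j _ => norm_nonneg _) (Finset.mem_univ i)⟩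
  have hg := (tendsto_gradient_gdIter (differentiable_logitLoss a b x)
    (fun w => (logitLoss_pos ha w).le) hη w₀).norm
  have hsmall : ∀ᶠ t in atTop, |η| * ‖gradient (logitLoss a b x) (w t)‖ * M ≤ 1 := by
    have h := (hg.const_mul |η|).mul_const M
    rw [norm_zero, mul_zero, zero_mul] at h
    exact (h.eventually_lt_const one_pos).mono fun t => le_of_lt
  -- The right side is the rate one step achieves. Its two corrections, the second-order error and
  -- the ratio of loss to weight, both tend to one.
  have hrate : ∀ᶠ t in atTop, m < (1 - η * M ^ 2 * logitWeight a b x (w t)) * ‖v‖⁻¹ /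
      (1 + ∑ i, Real.exp (b i - ⟪w t, x i⟫_ℝ)) := by
    have h1 := (((tendsto_logitWeight_gdIter hv.1 ha hη w₀).const_mul
      (η * M ^ 2)).const_sub 1).mul_const ‖v‖⁻¹
    have h2 := (tendsto_finsetSum Finset.univ fun i _ =>
      tendsto_exp_sub_inner_gdIter hv.1 ha hη w₀ i).const_add 1
    have h3 := h1.div h2 (by simp)
    simp only [mul_zero, sub_zero, one_mul, Finset.sum_const_zero, add_zero, div_one] at h3
    exact h3.eventually_const_lt hm
  have hq : ∀ᶠ t in atTop, η * M ^ 2 * logitWeight a b x (w t) < 1 := by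
    have h := (tendsto_logitWeight_gdIter hv.1 ha hη w₀).const_mul (η * M ^ 2)
    rw [mul_zero] at h
    exact h.eventually_lt_const one_pos
  filter_upwards [hsmall, hrate, hq] with t ht1 ht2 ht3
  have hsucc : w (t + 1) = w t - η • gradient (logitLoss a b x) (w t) := rfl
  have hdesc := logitLoss_gradient_step_le ha hM (w t) ht1
  rw [← hsucc] at hdesc
  have hstep : ‖w (t + 1) - w t‖ = η * ‖gradient (logitLoss a b x) (w t)‖ := by
    rw [hsucc, sub_sub_cancel_left, norm_neg, norm_smul, Real.norm_eq_abs, abs_of_pos hη0]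
  have hG := logitWeight_le_norm_gradient (b := b) ha hv.1 (w t)
  set g := ‖gradient (logitLoss a b x) (w t)‖
  set G := logitWeight a b x (w t)
  set c := ∑ i, Real.exp (b i - ⟪w t, x i⟫_ℝ)
  have hc : 0 ≤ c := Finset.sum_nonneg fun i _ => (Real.exp_pos _).le
  have hLG : logitLoss a b x (w t) ≤ (1 + c) * G :=
    logitLoss_le_mul_logitWeight ha fun i =>
      Finset.single_le_sum (f := fun i => Real.exp (b i - ⟪w t, x i⟫_ℝ))
        (fun j _ => (Real.exp_pos _).le) (Finset.mem_univ i)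
  have hL := logitLoss_pos (b := b) (x := x) ha (w t)
  have hL' := logitLoss_pos (b := b) (x := x) ha (w (t + 1))
  set L := logitLoss a b x (w t)
  have hLg : L ≤ (1 + c) * (‖v‖ * g) :=
    hLG.trans (mul_le_mul_of_nonneg_left hG (by linarith))
  have hmL : m * L ≤ (1 - η * M ^ 2 * G) * g := by
    calc m * L ≤ (1 - η * M ^ 2 * G) * ‖v‖⁻¹ / (1 + c) * L :=
          mul_le_mul_of_nonneg_right ht2.le hL.le
      _ ≤ (1 - η * M ^ 2 * G) * ‖v‖⁻¹ / (1 + c) * ((1 + c) * (‖v‖ * g)) :=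
          mul_le_mul_of_nonneg_left hLg (div_nonneg
            (mul_nonneg (by linarith) (inv_pos.2 hpos).le) (by linarith))
      _ = _ := by
          have : 1 + c ≠ 0 := by linarith
          field_simp
  -- Divide the descent estimate by `L`, using `hmL` for one of the two factors `g`.
  have hratio : logitLoss a b x (w (t + 1)) / L - 1 ≤ -(m * (η * g)) := by
    have h1 := mul_le_mul_of_nonneg_left hmL (mul_nonneg hη0.le (norm_nonneg _ : 0 ≤ g))
    rw [sub_le_iff_le_add, div_le_iff₀ hL]
    nlinarith
  have hlog := Real.log_le_sub_one_of_pos (div_pos hL' hL)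
  rw [Real.log_div hL'.ne' hL.ne'] at hlog
  rw [hstep]
  linarith

theorem isGDDirection_logitLoss (hv : IsMinNorm (marginSet x) v) (ha : ∀ i, 0 < a i) :
    IsGDDirection (logitLoss a b x) (‖v‖⁻¹ • v) := by
  refine ⟨exists_admissibleStep_logitLoss a b x, fun η w₀ hη => ?_⟩
  have hloss := tendsto_logitLoss_gdIter hv.1 ha hη w₀
  have hnorm := tendsto_norm_gdIter_logitLoss hv.1 ha hη w₀
  refine ⟨?_, hnorm, ?_⟩
  · have hinf : ⨅ w, logitLoss a b x w = 0 := by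
      refine le_antisymm (ge_of_tendsto' hloss fun t => ciInf_le ?_ _)
        (le_ciInf fun w => (logitLoss_pos ha w).le)
      exact ⟨0, by rintro _ ⟨w, rfl⟩; exact (logitLoss_pos ha w).le⟩
    rwa [hinf]
  refine hv.tendsto_direction_of_log_logitLoss_le (b := b) ha hnorm
    (Eventually.of_forall fun t => le_rfl) fun m hm => ?_
  -- A positive rate is needed, since the triangle inequality is multiplied by it; `m` itself may be
  -- negative.
  obtain ⟨m', h1, h2⟩ := exists_between (max_lt (inv_pos.2 hv.norm_pos) hm)
  rw [max_lt_iff] at h1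
  obtain ⟨t₀, ht₀⟩ := eventually_atTop.1
    (eventually_log_logitLoss_gdIter_succ_le hv ha hη w₀ h2)
  set w := gdIter (logitLoss a b x) η w₀
  have key : ∀ t ≥ t₀, Real.log (logitLoss a b x (w t)) ≤
      Real.log (logitLoss a b x (w t₀)) - m' * ‖w t - w t₀‖ := by
    intro t ht
    induction t, ht using Nat.le_induction with
    | base => simp
    | succ t ht ih =>
      have h3 := ht₀ t ht
      have h4 := norm_sub_le_norm_sub_add_norm_sub (w (t + 1)) (w t) (w t₀)
      nlinarith
  refine ⟨Real.log (logitLoss a b x (w t₀)) + m' * ‖w t₀‖, ?_⟩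
  filter_upwards [eventually_ge_atTop t₀] with t ht
  have h3 := key t ht
  have h4 := norm_sub_norm_le (w t) (w t₀)
  have h5 := mul_le_mul_of_nonneg_left h4 h1.1.le
  have h6 := mul_le_mul_of_nonneg_right h1.2.le (norm_nonneg (w t))
  linarith

theorem isTrained_logitLoss [FiniteDimensional ℝ E] (hv : IsMinNorm (marginSet x) v)
    (ha : ∀ i, 0 < a i) : IsTrained (logitLoss a b x) (‖v‖⁻¹ • v) :=
  ⟨isGDDirection_logitLoss hv ha, isPathDirection_logitLoss hv ha⟩

end Direction

/-! ### The four losses as logistic losses -/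

section Features

variable {d n : ℕ}

/-- Signed features of the binary model with multiplicative parameters `δ`. -/
noncomputable def vsFeature (δ : Fin 2 → ℝ) (h : Fin n → Feat d) (y : Fin n → Fin 2)
    (i : Fin n) : Feat d :=
  (signLabel (y i) * δ (y i)) • h i

/-- Signed features of the two-class CDT model. -/
noncomputable def cdtFeature (δ : Fin 2 → ℝ) (h : Fin n → Feat d) (y : Fin n → Fin 2)
    (i : Fin n) : Classifier d 2 :=
  WithLp.toLp 2 fun c => ((if c = y i then 1 else -1) * δ c) • h i

/-- Signed features of the two-class LDT model. -/
noncomputable def ldtFeature (δ : Fin 2 → ℝ) (h : Fin n → Feat d) (y : Fin n → Fin 2)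
    (i : Fin n) : Classifier d 2 :=
  WithLp.toLp 2 fun c => ((if c = y i then 1 else -1) * δ (y i)) • h i

variable (δ : Fin 2 → ℝ) (h : Fin n → Feat d) (y : Fin n → Fin 2)

theorem erase_eq_singleton_rev (c : Fin 2) : Finset.univ.erase c = {c.rev} := by
  revert c
  decide

theorem ne_iff_eq_rev (c e : Fin 2) : c ≠ e ↔ c = e.rev := by
  revert c e
  decide

theorem inner_vsFeature (w : Feat d) (i : Fin n) :
    ⟪w, vsFeature δ h y i⟫_ℝ = signLabel (y i) * δ (y i) * ⟪w, h i⟫_ℝ := by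
  rw [vsFeature, inner_smul_right]

theorem inner_cdtFeature (W : Classifier d 2) (i : Fin n) :
    ⟪W, cdtFeature δ h y i⟫_ℝ =
      ⟪δ (y i) • W (y i) - δ (y i).rev • W (y i).rev, h i⟫_ℝ := by
  rw [PiLp.inner_apply, Fin.sum_univ_two, inner_sub_left, real_inner_smul_left,
    real_inner_smul_left]
  simp only [cdtFeature, inner_smul_right]
  obtain hy | hy : y i = 0 ∨ y i = 1 := by omega
  · simp only [hy, if_true, one_ne_zero, if_false, show (0 : Fin 2).rev = 1 from rfl]
    ring
  · simp only [hy, if_true, zero_ne_one, if_false, show (1 : Fin 2).rev = 0 from rfl]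
    ring

theorem inner_ldtFeature (W : Classifier d 2) (i : Fin n) :
    ⟪W, ldtFeature δ h y i⟫_ℝ = δ (y i) * ⟪W (y i) - W (y i).rev, h i⟫_ℝ := by
  rw [PiLp.inner_apply, Fin.sum_univ_two, inner_sub_left]
  simp only [ldtFeature, inner_smul_right]
  obtain hy | hy : y i = 0 ∨ y i = 1 := by omega
  · simp only [hy, if_true, one_ne_zero, if_false, show (0 : Fin 2).rev = 1 from rfl]
    ring
  · simp only [hy, if_true, zero_ne_one, if_false, show (1 : Fin 2).rev = 0 from rfl]
    ring

theorem vsFeasible_eq_marginSet : vsFeasible δ h y = marginSet (vsFeature δ h y) := by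
  ext w
  simp only [vsFeasible, marginSet, inner_vsFeature]

theorem ceFeasible_eq_vsFeasible : ceFeasible h y = vsFeasible (fun _ => 1) h y := by
  simp only [ceFeasible, vsFeasible, mul_one]

theorem cdtFeasible_eq_marginSet : cdtFeasible δ h y = marginSet (cdtFeature δ h y) := by
  ext W
  simp only [cdtFeasible, marginSet, inner_cdtFeature, ne_iff_eq_rev, forall_eq]

theorem ldtFeasible_eq_marginSet : ldtFeasible δ h y = marginSet (ldtFeature δ h y) := by
  ext W
  simp only [ldtFeasible, marginSet, inner_ldtFeature, ne_iff_eq_rev, forall_eq]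

theorem vsLoss_eq_logitLoss (ι ω : Fin 2 → ℝ) : vsLoss δ ι ω h y =
    logitLoss (fun i => ω (y i)) (fun i => ι (y i)) (vsFeature δ h y) := by
  ext w
  simp only [vsLoss, logitLoss, inner_vsFeature, sub_eq_add_neg, Real.exp_add]

theorem ceLoss_eq_vsLoss :
    ceLoss h y = vsLoss (fun _ => 1) (fun _ => 0) (fun _ => 1) h y := by
  ext w
  simp only [ceLoss, vsLoss, Real.exp_zero, one_mul, mul_one]

theorem cdtLoss_eq_logitLoss : cdtLoss δ h y =
    logitLoss (fun _ => 1) (fun _ => 0) (cdtFeature δ h y) := by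
  ext W
  simp only [cdtLoss, logitLoss, inner_cdtFeature, erase_eq_singleton_rev, Finset.sum_singleton,
    one_mul, zero_sub]

theorem ldtLoss_eq_logitLoss : ldtLoss δ h y =
    logitLoss (fun _ => 1) (fun _ => 0) (ldtFeature δ h y) := by
  ext W
  simp only [ldtLoss, logitLoss, inner_ldtFeature, erase_eq_singleton_rev, Finset.sum_singleton,
    one_mul, zero_sub]

variable {δ h y}

/-! ### Relations between the max-margin problems -/

theorem mem_ldtFeasible_iff {W : Classifier d 2} :
    W ∈ ldtFeasible δ h y ↔ W 0 - W 1 ∈ vsFeasible δ h y := by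
  rw [ldtFeasible_eq_marginSet, vsFeasible_eq_marginSet]
  refine forall_congr' fun i => ?_
  rw [inner_ldtFeature, inner_vsFeature, inner_sub_left, inner_sub_left]
  obtain hy | hy : y i = 0 ∨ y i = 1 := by omega
  · simp [hy, signLabel, show (0 : Fin 2).rev = 1 from rfl]
  · have : δ 1 * (⟪W 1, h i⟫_ℝ - ⟪W 0, h i⟫_ℝ) = -1 * δ 1 * (⟪W 0, h i⟫_ℝ - ⟪W 1, h i⟫_ℝ) := by
      ring
    simp only [hy, signLabel, one_ne_zero, if_false, show (1 : Fin 2).rev = 0 from rfl, this]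

/-- CDT temperatures belong to columns, not labels: the label only flips the sign of one fixed
combination, which absorbs `δ`. -/
theorem mem_cdtFeasible_iff {W : Classifier d 2} :
    W ∈ cdtFeasible δ h y ↔ δ 0 • W 0 - δ 1 • W 1 ∈ ceFeasible h y := by
  rw [cdtFeasible_eq_marginSet]
  refine forall_congr' fun i => ?_
  rw [inner_cdtFeature, inner_sub_left, inner_sub_left]
  obtain hy | hy : y i = 0 ∨ y i = 1 := by omega
  · simp [hy, signLabel, show (0 : Fin 2).rev = 1 from rfl]
  · simp [hy, signLabel, show (1 : Fin 2).rev = 0 from rfl]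

/-- Minimum-norm points over the preimage of `S` under `W ↦ p W₁ - q W₂`. -/
theorem IsMinNorm.classifier {S : Set (Feat d)} {T : Set (Classifier d 2)} {p q : ℝ} (hp : 0 < p)
    (hT : ∀ W : Classifier d 2, W ∈ T ↔ p • W 0 - q • W 1 ∈ S) {w : Feat d}
    (hw : IsMinNorm S w) :
    IsMinNorm T (WithLp.toLp 2
      ![(p / (p ^ 2 + q ^ 2)) • w, -((q / (p ^ 2 + q ^ 2)) • w)]) := by
  have hpq : 0 < p ^ 2 + q ^ 2 := by positivity
  refine ⟨?_, fun V hV => ?_⟩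
  · rw [hT]
    have : p • (p / (p ^ 2 + q ^ 2)) • w - q • -((q / (p ^ 2 + q ^ 2)) • w) = w := by
      rw [smul_neg, sub_neg_eq_add, smul_smul, smul_smul, ← add_smul]
      convert one_smul ℝ w
      field_simp
    exact this.symm ▸ hw.1
  · have h1 := hw.2 _ ((hT V).1 hV)
    rw [PiLp.norm_sq_eq_of_L2, PiLp.norm_sq_eq_of_L2, Fin.sum_univ_two, Fin.sum_univ_two]
    simp only [Matrix.cons_val_zero, Matrix.cons_val_one, norm_neg, norm_smul, mul_pow,
      Real.norm_eq_abs, sq_abs]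
    -- Cauchy–Schwarz; with `h1` it gives `‖V‖² ≥ ‖w‖² / (p² + q²)`, the squared norm of the
    -- candidate.
    have h2 : ‖p • V 0 - q • V 1‖ ^ 2 ≤ (p ^ 2 + q ^ 2) * (‖V 0‖ ^ 2 + ‖V 1‖ ^ 2) := by
      have h3 := norm_sub_le (p • V 0) (q • V 1)
      rw [norm_smul, norm_smul, Real.norm_eq_abs, Real.norm_eq_abs] at h3
      calc _ ≤ (|p| * ‖V 0‖ + |q| * ‖V 1‖) ^ 2 := by gcongr
        _ ≤ (|p| ^ 2 + |q| ^ 2) * (‖V 0‖ ^ 2 + ‖V 1‖ ^ 2) := by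
          nlinarith [sq_nonneg (|p| * ‖V 1‖ - |q| * ‖V 0‖)]
        _ = _ := by rw [sq_abs, sq_abs]
    calc _ = ‖w‖ ^ 2 / (p ^ 2 + q ^ 2) := by field_simp
      _ ≤ _ := by
        rw [div_le_iff₀ hpq, mul_comm]
        exact h1.trans h2

end Features

/-! ### Uniqueness and classification rules -/

/-- An admissible step exists, so the gradient descent limit from `0` determines the direction. -/
theorem IsTrained.unique {E : Type*} [NormedAddCommGroup E] [InnerProductSpace ℝ E]
    [CompleteSpace E] {L : E → ℝ} {v w : E} (hv : IsTrained L v) (hw : IsTrained L w) : v = w := by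
  obtain ⟨η, hη⟩ := hv.1.1
  exact tendsto_nhds_unique (hv.1.2 η 0 hη).2.2 (hw.1.2 η 0 hη).2.2

theorem twoClassRule_eq_binaryRule {d : ℕ} {W : Classifier d 2} {w : Feat d} {c : ℝ} (hc : 0 < c)
    (h : W 0 - W 1 = c • w) (x : Feat d) : twoClassRule W x = binaryRule w x := by
  rw [twoClassRule, binaryRule, h, real_inner_smul_left, sign_mul, sign_pos hc, one_mul]

theorem twoClassRule_smul {d : ℕ} (W : Classifier d 2) {c : ℝ} (hc : 0 < c) (x : Feat d) :
    twoClassRule (c • W) x = twoClassRule W x := by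
  rw [twoClassRule, twoClassRule, PiLp.smul_apply, PiLp.smul_apply, ← smul_sub,
    real_inner_smul_left, sign_mul, sign_pos hc, one_mul]

theorem binaryRule_smul {d : ℕ} (w : Feat d) {c : ℝ} (hc : 0 < c) (x : Feat d) :
    binaryRule (c • w) x = binaryRule w x := by
  rw [binaryRule, binaryRule, real_inner_smul_left, sign_mul, sign_pos hc, one_mul]

theorem mainTheorem1 {d n : ℕ} (hn : 0 < n) (h : Fin n → Feat d) (y : Fin n → Fin 2)
    (hsep : Separable h y) (δ : Fin 2 → ℝ) (hδ : ∀ c, 0 < δ c)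
    (ι ω : Fin 2 → ℝ) (hω : ∀ c, 0 < ω c) :
    -- LDT gives the rule of the binary VS loss with the same `δ`
    (∀ (W : Classifier d 2) (w : Feat d),
      IsTrained (ldtLoss δ h y) W → IsTrained (vsLoss δ ι ω h y) w →
        ∀ x, twoClassRule W x = binaryRule w x) ∧
    -- CDT gives the rule of binary CE, whatever `δ`
    (∀ (W : Classifier d 2) (w : Feat d),
      IsTrained (cdtLoss δ h y) W → IsTrained (ceLoss h y) w →
        ∀ x, twoClassRule W x = binaryRule w x) ∧
    -- the four trained classifiers exist: they are the directions of the max-margin solutions,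
    -- which are unique and related explicitly
    ∃ (Wldt Wcdt : Classifier d 2) (wce wvs : Feat d),
      (∀ W, IsMinNorm (ldtFeasible δ h y) W ↔ W = Wldt) ∧
      (∀ W, IsMinNorm (cdtFeasible δ h y) W ↔ W = Wcdt) ∧
      (∀ w, IsMinNorm (ceFeasible h y) w ↔ w = wce) ∧
      (∀ w, IsMinNorm (vsFeasible δ h y) w ↔ w = wvs) ∧
      IsTrained (ldtLoss δ h y) (‖Wldt‖⁻¹ • Wldt) ∧
      IsTrained (cdtLoss δ h y) (‖Wcdt‖⁻¹ • Wcdt) ∧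
      IsTrained (ceLoss h y) (‖wce‖⁻¹ • wce) ∧
      IsTrained (vsLoss δ ι ω h y) (‖wvs‖⁻¹ • wvs) ∧
      Wldt 0 = (1 / 2 : ℝ) • wvs ∧ Wldt 1 = -((1 / 2 : ℝ) • wvs) ∧
      Wcdt 0 = (δ 0 / (δ 0 ^ 2 + δ 1 ^ 2)) • wce ∧
      Wcdt 1 = -((δ 1 / (δ 0 ^ 2 + δ 1 ^ 2)) • wce) := by
  have : Nonempty (Fin n) := ⟨⟨0, hn⟩⟩
  obtain ⟨u, hu⟩ := hsep
  have hex : ∀ ε : Fin 2 → ℝ, (∀ c, 0 < ε c) → ∃ w, IsMinNorm (vsFeasible ε h y) w := by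
    intro ε hε
    rw [vsFeasible_eq_marginSet]
    refine exists_isMinNorm_marginSet (w := u) fun i => ?_
    rw [inner_vsFeature, mul_right_comm]
    exact mul_pos (hu i) (hε _)
  obtain ⟨wvs, hvs⟩ := hex δ hδ
  obtain ⟨wce, hce⟩ := hex (fun _ => 1) fun _ => one_pos
  have hldt : IsMinNorm (ldtFeasible δ h y)
      (WithLp.toLp 2 ![(1 / 2 : ℝ) • wvs, -((1 / 2 : ℝ) • wvs)]) := by
    have h1 := hvs.classifier (T := ldtFeasible δ h y) one_pos (q := 1)
      fun W => by rw [mem_ldtFeasible_iff, one_smul, one_smul]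
    norm_num at h1 ⊢
    exact h1
  have hcdt : IsMinNorm (cdtFeasible δ h y) (WithLp.toLp 2
      ![(δ 0 / (δ 0 ^ 2 + δ 1 ^ 2)) • wce, -((δ 1 / (δ 0 ^ 2 + δ 1 ^ 2)) • wce)]) :=
    hce.classifier (hδ 0) fun W => by rw [mem_cdtFeasible_iff, ceFeasible_eq_vsFeasible]
  set Wldt : Classifier d 2 := WithLp.toLp 2 ![(1 / 2 : ℝ) • wvs, -((1 / 2 : ℝ) • wvs)]
  set Wcdt : Classifier d 2 := WithLp.toLp 2
    ![(δ 0 / (δ 0 ^ 2 + δ 1 ^ 2)) • wce, -((δ 1 / (δ 0 ^ 2 + δ 1 ^ 2)) • wce)]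
  rw [vsFeasible_eq_marginSet] at hvs hce
  rw [ldtFeasible_eq_marginSet] at hldt
  rw [cdtFeasible_eq_marginSet] at hcdt
  have tldt : IsTrained (ldtLoss δ h y) (‖Wldt‖⁻¹ • Wldt) := by
    rw [ldtLoss_eq_logitLoss]
    exact isTrained_logitLoss hldt fun _ => one_pos
  have tcdt : IsTrained (cdtLoss δ h y) (‖Wcdt‖⁻¹ • Wcdt) := by
    rw [cdtLoss_eq_logitLoss]
    exact isTrained_logitLoss hcdt fun _ => one_pos
  have tvs : IsTrained (vsLoss δ ι ω h y) (‖wvs‖⁻¹ • wvs) := by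
    rw [vsLoss_eq_logitLoss]
    exact isTrained_logitLoss hvs fun i => hω (y i)
  have tce : IsTrained (ceLoss h y) (‖wce‖⁻¹ • wce) := by
    rw [ceLoss_eq_vsLoss, vsLoss_eq_logitLoss]
    exact isTrained_logitLoss hce fun _ => one_pos
  refine ⟨fun W w hW hw x => ?_, fun W w hW hw x => ?_, Wldt, Wcdt, wce, wvs, ?_, ?_, ?_, ?_,
    tldt, tcdt, tce, tvs, rfl, rfl, rfl, rfl⟩
  · rw [hW.unique tldt, hw.unique tvs, twoClassRule_smul _ (inv_pos.2 hldt.norm_pos),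
      binaryRule_smul _ (inv_pos.2 hvs.norm_pos)]
    refine twoClassRule_eq_binaryRule one_pos ?_ x
    change (1 / 2 : ℝ) • wvs - -((1 / 2 : ℝ) • wvs) = _
    module
  · rw [hW.unique tcdt, hw.unique tce, twoClassRule_smul _ (inv_pos.2 hcdt.norm_pos),
      binaryRule_smul _ (inv_pos.2 hce.norm_pos)]
    have h0 := hδ 0
    have h1 := hδ 1
    -- The column difference is `(δ 0 + δ 1) / (δ 0 ^ 2 + δ 1 ^ 2)` times `wce`.
    refine twoClassRule_eq_binaryRule
      (by positivity : 0 < δ 0 / (δ 0 ^ 2 + δ 1 ^ 2) + δ 1 / (δ 0 ^ 2 + δ 1 ^ 2)) ?_ x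
    change (δ 0 / (δ 0 ^ 2 + δ 1 ^ 2)) • wce - -((δ 1 / (δ 0 ^ 2 + δ 1 ^ 2)) • wce) = _
    module
  · rw [ldtFeasible_eq_marginSet]
    exact hldt.iff_eq (convex_marginSet _)
  · rw [cdtFeasible_eq_marginSet]
    exact hcdt.iff_eq (convex_marginSet _)
  · rw [ceFeasible_eq_vsFeasible, vsFeasible_eq_marginSet]
    exact hce.iff_eq (convex_marginSet _)
  · rw [vsFeasible_eq_marginSet]
    exact hvs.iff_eq (convex_marginSet _)
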